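/- For $n\in\mathbb{N}_0$ let $L_n(x)=\sum_{k=0}^n\binom{n}{k}\frac{(-x)^k}{k!}$ be the Laguerre polynomials and $\phi_n(x)=e^{-x}L_n(2x)$ the Laguerre functions. For $N\in\mathbb{N}_0$ let $\Pi_N$ be the orthogonal projection of $L^2([0,\infty))$ (complex-valued functions) onto $\operatorname{span}\{\phi_0,\dots,\phi_N\}$. For $a\in\mathbb{C}\setminus(-\infty,0]$ and $b\in\mathbb{C}$ with $\operatorname{Re} b>0$ put $$\varepsilon(N,a,b)=\Big\|(I-\Pi_N)\Big(\frac{1}{a+\cdot}\,\Pi_N e^{-b\,\cdot}\Big)\Big\|_{L^2([0,\infty))}.$$ Then for all such $a$ and $b$ there is a constant $C>0$, independent of $N$, such that for every $N\in\mathbb{N}_0$ $$\varepsilon(N,a,b)\le C\exp\!\big(-2\operatorname{Re}\sqrt{2a(N+1)}\big),$$ where $\sqrt{\cdot}$ is the principal branch of the square root. -/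

import Mathlib

open MeasureTheory

noncomputable section

namespace LaguerreApprox

/-- Lebesgue measure on the half line `[0, ∞)`. -/
abbrev halfLine : Measure ℝ := volume.restrict (Set.Ici 0)

/-- The complex Hilbert space `L²([0, ∞))`. -/
abbrev L2 : Type := Lp ℂ 2 halfLine

/-- The Laguerre polynomial `L_n(x) = ∑_{k=0}^n (n choose n-k) (-x)^k / k!`. -/
def laguerre (n : ℕ) (x : ℂ) : ℂ :=
  ∑ k ∈ Finset.range (n + 1), (n.choose (n - k) : ℂ) * ((-x) ^ k / (k.factorial : ℂ))

/-- The Laguerre function `φ_n(x) = exp(-x) L_n(2x)`. -/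
def laguerreFun (n : ℕ) (x : ℂ) : ℂ := Complex.exp (-x) * laguerre n (2 * x)

/-- Monomials times exponentials of negative rate are square integrable on the half line. -/
theorem memLp_pow_mul_exp (k : ℕ) {b : ℂ} (hb : 0 < b.re) :
    MemLp (fun ξ : ℝ => (ξ : ℂ) ^ k * Complex.exp (-b * ξ)) 2 halfLine := by
  have hc : Continuous (fun ξ : ℝ => (ξ : ℂ) ^ k * Complex.exp (-b * ξ)) := by fun_prop
  rw [memLp_two_iff_integrable_sq_norm hc.aestronglyMeasurable]
  have h := integrableOn_rpow_mul_exp_neg_mul_rpow (p := 1) (s := ((2 * k : ℕ) : ℝ))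
    (b := 2 * b.re) (by have : (0 : ℝ) ≤ ((2 * k : ℕ) : ℝ) := Nat.cast_nonneg _
                        linarith) one_pos (by linarith)
  rw [← integrableOn_Ici_iff_integrableOn_Ioi (by finiteness)] at h
  refine Integrable.congr h (Filter.Eventually.of_forall fun ξ => ?_)
  simp only [Real.rpow_natCast, Real.rpow_one, norm_mul, norm_pow, Complex.norm_real,
    Complex.norm_exp, mul_pow, ← Real.exp_nat_mul, Real.norm_eq_abs]
  rw [← pow_mul, mul_comm k 2, pow_mul |ξ|, sq_abs, ← pow_mul]
  congr 2
  simp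
  ring

theorem memLp_exp {b : ℂ} (hb : 0 < b.re) :
    MemLp (fun ξ : ℝ => Complex.exp (-b * ξ)) 2 halfLine := by
  simpa using memLp_pow_mul_exp 0 hb

theorem memLp_laguerreFun (n : ℕ) :
    MemLp (fun ξ : ℝ => laguerreFun n ξ) 2 halfLine := by
  have h := memLp_finsetSum (μ := halfLine) (p := 2) (Finset.range (n + 1))
    (f := fun k (ξ : ℝ) => ((n.choose (n - k) : ℂ) * (-2) ^ k / (k.factorial : ℂ)) *
      ((ξ : ℂ) ^ k * Complex.exp (-1 * ξ)))
    (fun k _ => (memLp_pow_mul_exp k (b := 1) (by simp)).const_mul _)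
  refine (memLp_congr_ae (Filter.Eventually.of_forall fun ξ => ?_)).1 h
  simp only [laguerreFun, laguerre, Finset.mul_sum]
  refine Finset.sum_congr rfl fun k _ => ?_
  rw [show (-(2 * (ξ : ℂ))) = (-2) * ξ by ring, mul_pow, neg_one_mul]
  ring

/-- `exp(-b·)` as an element of `L²([0, ∞))`, for `Re b > 0`. -/
def expL2 (b : ℂ) (hb : 0 < b.re) : L2 := (memLp_exp hb).toLp _

/-- `φ_n` as an element of `L²([0, ∞))`. -/
def phi (n : ℕ) : L2 := (memLp_laguerreFun n).toLp _

/-- The space spanned by `φ_0, …, φ_N`. -/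
def laguerreSpace (N : ℕ) : Submodule ℂ L2 :=
  Submodule.span ℂ (Set.range fun n : Fin (N + 1) => phi n)

instance (N : ℕ) : FiniteDimensional ℂ (laguerreSpace N) :=
  FiniteDimensional.span_of_finite ℂ (Set.finite_range _)

/-- The `L²`-orthogonal projection `Π_N` onto the span of `φ_0, …, φ_N`. -/
def proj (N : ℕ) : L2 →L[ℂ] L2 := (laguerreSpace N).starProjection

/-- For `a` off the closed negative real axis, `1 / (a + ·)` is bounded on the half line. -/
theorem exists_bound_inv {a : ℂ} (ha : a ∈ Complex.slitPlane) :
    ∃ M : ℝ, ∀ ξ : ℝ, 0 ≤ ξ → ‖1 / (a + (ξ : ℂ))‖ ≤ M := by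
  rcases Complex.mem_slitPlane_iff.1 ha with h | h
  · refine ⟨1 / a.re, fun ξ hξ => ?_⟩
    rw [norm_div, norm_one]
    refine one_div_le_one_div_of_le h ?_
    have := (le_abs_self _).trans (Complex.abs_re_le_norm (a + (ξ : ℂ)))
    simp only [Complex.add_re, Complex.ofReal_re] at this
    linarith
  · refine ⟨1 / |a.im|, fun ξ _ => ?_⟩
    rw [norm_div, norm_one]
    refine one_div_le_one_div_of_le (abs_pos.2 h) ?_
    simpa using Complex.abs_im_le_norm (a + (ξ : ℂ))

theorem memLp_inv_mul {a : ℂ} (ha : a ∈ Complex.slitPlane) (f : L2) :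
    MemLp (fun ξ : ℝ => 1 / (a + (ξ : ℂ)) * f ξ) 2 halfLine := by
  obtain ⟨M, hM⟩ := exists_bound_inv ha
  have hm : Measurable fun ξ : ℝ => 1 / (a + (ξ : ℂ)) := by fun_prop
  refine (Lp.memLp f).of_le_mul (c := M)
    (hm.aestronglyMeasurable.mul (Lp.aestronglyMeasurable f)) ?_
  filter_upwards [ae_restrict_mem measurableSet_Ici] with ξ hξ
  rw [norm_mul]
  exact mul_le_mul_of_nonneg_right (hM ξ hξ) (norm_nonneg _)

/-- Pointwise multiplication of `f ∈ L²([0, ∞))` by `1 / (a + ·)`. -/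
def invMul (a : ℂ) (ha : a ∈ Complex.slitPlane) (f : L2) : L2 := (memLp_inv_mul ha f).toLp _

/-- `ε(N, a, b) = ‖(I - Π_N) (1 / (a + ·)) Π_N exp(-b·)‖` in `L²([0, ∞))`. -/
def divError (N : ℕ) (a b : ℂ) (ha : a ∈ Complex.slitPlane) (hb : 0 < b.re) : ℝ :=
  ‖invMul a ha (proj N (expL2 b hb)) - proj N (invMul a ha (proj N (expL2 b hb)))‖

end LaguerreApprox

end

noncomputable section

namespace LaguerreApprox

open Filter Topology ComplexConjugate

/-! For a polynomial `p` of degree at most `N + 1`, `(p(x) - p(-a)) / (a + x)` has degree at most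
`N`. Hence `I - Π_N` sends `φ_m / (a + ·)`, `m ≤ N`, to `L_m(-2a)` times the residual of `h = e^{-x}
/ (a + x)`, and the error is a product (`divError_eq`). The scalar factor `∑ 2 (b-1)^m / (b+1)^(m+1)
L_m(-2a)` is bounded in `N`: `|(b-1)/(b+1)| < 1` and `L_m` grows subexponentially in `m`.

For the other factor put `α = √a`. A Laplace integral along the ray `t = u² / α` writes `h` as a
superposition of exponentials `e^{-s x}`, `s = 1 + u² / α`, with weight of modulus proportional to
`u e^{-Re α u²}`. Their projection error is explicit, `|(s-1)/(s+1)|^(N+1) / √(2 Re s)`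
(`norm_sub_proj_powExp_zero_sq`). A saddle-point bound (`saddle_exponent_le`) dominates the
integrand by `exp(-2 Re α √(2(N+1)))` times a Gaussian in `u` of fixed width, whose mass does not
depend on `N`. -/

/-! ### Moments of exponentials and orthogonality of the Laguerre functions. -/

theorem integrable_pow_mul_exp (k : ℕ) {s : ℂ} (hs : 0 < s.re) :
    Integrable (fun x : ℝ => (x : ℂ) ^ k * Complex.exp (-s * x)) halfLine := by
  have h := (memLp_pow_mul_exp k (b := s / 2) (by simpa using hs)).integrable_mul
    (memLp_exp (b := s / 2) (by simpa using hs))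
  refine h.congr (Eventually.of_forall fun x => ?_)
  simp only [Pi.mul_apply]
  rw [mul_assoc, ← Complex.exp_add]
  ring_nf

theorem hasDerivAt_pow_mul_exp (k : ℕ) (s : ℂ) (x : ℝ) :
    HasDerivAt (fun x : ℝ => (x : ℂ) ^ (k + 1) * Complex.exp (-s * x))
      ((k + 1) * ((x : ℂ) ^ k * Complex.exp (-s * x))
        - s * ((x : ℂ) ^ (k + 1) * Complex.exp (-s * x))) x := by
  have h1 : HasDerivAt (fun z : ℂ => z ^ (k + 1) * Complex.exp (-s * z))
      (((k + 1 : ℕ) : ℂ) * (x : ℂ) ^ k * Complex.exp (-s * x)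
        + (x : ℂ) ^ (k + 1) * (Complex.exp (-s * x) * (-s * 1))) (x : ℂ) :=
    (by simpa using hasDerivAt_pow (k + 1) (x : ℂ) :
      HasDerivAt (fun z : ℂ => z ^ (k + 1)) (((k + 1 : ℕ) : ℂ) * (x : ℂ) ^ k) x).mul
      (((hasDerivAt_id (x : ℂ)).const_mul (-s)).cexp)
  convert! h1.comp_ofReal using 1
  push_cast
  ring

theorem integral_pow_mul_exp (k : ℕ) {s : ℂ} (hs : 0 < s.re) :
    ∫ x : ℝ, (x : ℂ) ^ k * Complex.exp (-s * x) ∂halfLine = k.factorial / s ^ (k + 1) := by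
  have hs0 : s ≠ 0 := by rintro rfl; simp at hs
  induction k with
  | zero =>
    rw [integral_Ici_eq_integral_Ioi]
    have := integral_exp_mul_complex_Ioi (a := -s) (by simpa using hs) 0
    simp only [pow_zero, one_mul, this]
    simp
  | succ k ih =>
    have i1 := integrable_pow_mul_exp k hs
    have i2 := integrable_pow_mul_exp (k + 1) hs
    have i3 := (i1.const_mul ((k : ℂ) + 1)).sub (i2.const_mul s)
    have hd := fun (x : ℝ) (_ : x ∈ Set.Ici (0 : ℝ)) => hasDerivAt_pow_mul_exp k s x
    have hd' := fun (x : ℝ) (_ : x ∈ Set.Ioi (0 : ℝ)) => hasDerivAt_pow_mul_exp k s x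
    have m : ∀ {f : ℝ → ℂ}, Integrable f halfLine → IntegrableOn f (Set.Ioi 0) := fun h =>
      IntegrableOn.mono_set (t := Set.Ici 0) h Set.Ioi_subset_Ici_self
    have ht := tendsto_zero_of_hasDerivAt_of_integrableOn_Ioi hd' (m i3) (m i2)
    have := integral_Ioi_of_hasDerivAt_of_tendsto' hd (m i3) ht
    rw [← integral_Ici_eq_integral_Ioi, integral_sub (i1.const_mul _) (i2.const_mul _),
      integral_const_mul, integral_const_mul, ih] at this
    have h2 : s * ∫ x : ℝ, (x : ℂ) ^ (k + 1) * Complex.exp (-s * x) ∂halfLine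
        = (k + 1) * (k.factorial / s ^ (k + 1)) := by
      have h0 : ((0 : ℝ) : ℂ) ^ (k + 1) * Complex.exp (-s * (0 : ℝ)) = 0 := by simp
      rw [h0] at this
      linear_combination -this
    apply mul_left_cancel₀ hs0
    rw [h2, Nat.factorial_succ]
    push_cast
    field_simp
    ring

/-- `x ^ k * exp (-s x)` as an element of `L²([0, ∞))`, for `Re s > 0`. -/
def powExp (k : ℕ) (s : ℂ) (hs : 0 < s.re) : L2 := (memLp_pow_mul_exp k hs).toLp _

theorem powExp_coeFn (k : ℕ) (s : ℂ) (hs : 0 < s.re) :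
    powExp k s hs =ᵐ[halfLine] fun x : ℝ => (x : ℂ) ^ k * Complex.exp (-s * x) :=
  MemLp.coeFn_toLp _

theorem expL2_eq_powExp (s : ℂ) (hs : 0 < s.re) : expL2 s hs = powExp 0 s hs := by
  simp [expL2, powExp]

theorem inner_powExp (j k : ℕ) (s t : ℂ) (hs : 0 < s.re) (ht : 0 < t.re) :
    inner ℂ (powExp j s hs) (powExp k t ht) = (j + k).factorial / (conj s + t) ^ (j + k + 1) := by
  rw [← integral_pow_mul_exp (j + k) (by simp; linarith), L2.inner_def]
  refine integral_congr_ae ?_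
  filter_upwards [powExp_coeFn j s hs, powExp_coeFn k t ht] with x h1 h2
  rw [h1, h2, RCLike.inner_apply]
  simp only [map_mul, map_pow, Complex.conj_ofReal, ← Complex.exp_conj, map_neg]
  rw [show -(conj s + t) * (x : ℂ) = -t * x + -conj s * x by ring, Complex.exp_add]
  ring

theorem phi_eq_sum (n : ℕ) :
    phi n = ∑ k ∈ Finset.range (n + 1),
      ((n.choose k : ℂ) * (-2) ^ k / k.factorial) • powExp k 1 (by simp) := by
  refine Lp.ext ?_
  refine (MemLp.coeFn_toLp _).trans ?_
  refine EventuallyEq.trans ?_ (Lp.coeFn_finsetSum _ _).symm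
  have h : ∀ᵐ x ∂halfLine, ∀ k : ℕ,
      (((n.choose k : ℂ) * (-2) ^ k / k.factorial) • powExp k 1 (by simp) : L2) x
        = ((n.choose k : ℂ) * (-2) ^ k / k.factorial) * ((x : ℂ) ^ k * Complex.exp (-1 * x)) := by
    rw [ae_all_iff]
    intro k
    filter_upwards [Lp.coeFn_smul ((n.choose k : ℂ) * (-2) ^ k / k.factorial)
      (powExp k 1 (by simp)), powExp_coeFn k 1 (by simp)] with x h1 h2
    rw [h1, Pi.smul_apply, h2, smul_eq_mul]
  filter_upwards [h] with x hx
  rw [Finset.sum_apply]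
  simp only [hx, laguerreFun, laguerre, Finset.mul_sum]
  refine Finset.sum_congr rfl fun k hk => ?_
  rw [Nat.choose_symm (Finset.mem_range_succ_iff.1 hk),
    show (-(2 * (x : ℂ))) = (-2) * x by ring, mul_pow, neg_one_mul]
  ring

/-- Termwise integration produces the binomial expansion of `(-2 + (s + 1))^n`. -/
theorem inner_phi_powExp_zero (n : ℕ) (s : ℂ) (hs : 0 < s.re) :
    inner ℂ (phi n) (powExp 0 s hs) = (s - 1) ^ n / (s + 1) ^ (n + 1) := by
  have h0 : s + 1 ≠ 0 := by
    intro h; have := congrArg Complex.re h; simp at this; linarith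
  rw [phi_eq_sum, sum_inner]
  simp only [inner_smul_left, inner_powExp]
  have e : s - 1 = -2 + (s + 1) := by ring
  rw [e, add_pow, Finset.sum_div]
  refine Finset.sum_congr rfl fun k hk => ?_
  have hk := Finset.mem_range_succ_iff.1 hk
  have : (k.factorial : ℂ) ≠ 0 := by exact_mod_cast k.factorial_ne_zero
  obtain ⟨m, rfl⟩ := Nat.exists_eq_add_of_le hk
  simp only [map_div₀, map_mul, map_natCast, map_pow, map_neg, map_ofNat, map_one, add_zero,
    Nat.add_sub_cancel_left, add_comm (1 : ℂ) s]
  field_simp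
  ring

/-- Up to sign this is the `n`-th forward difference at `1` of the rising factorial, a monic
polynomial of degree `k`: zero for `k < n`, and `n!` for `k = n`. -/
theorem sum_neg_one_pow_mul_choose_mul_ascFactorial (n k : ℕ) (hk : k ≤ n) :
    ∑ j ∈ Finset.range (n + 1), (-1 : ℂ) ^ j * n.choose j * ((j + 1).ascFactorial k : ℂ)
      = if k = n then (-1) ^ n * (n.factorial : ℂ) else 0 := by
  set P : Polynomial ℂ := ascPochhammer ℂ k
  have hP : P.natDegree = k := ascPochhammer_natDegree (S := ℂ) k
  have key : ∑ j ∈ Finset.range (n + 1), (-1 : ℂ) ^ j * n.choose j * ((j + 1).ascFactorial k : ℂ)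
      = (-1) ^ n * (fwdDiff (1 : ℂ))^[n] P.eval 1 := by
    rw [fwdDiff_iter_eq_sum_shift, Finset.mul_sum]
    refine Finset.sum_congr rfl fun j hj => ?_
    have hj := Finset.mem_range_succ_iff.1 hj
    obtain ⟨m, rfl⟩ := Nat.exists_eq_add_of_le hj
    rw [Nat.cast_ascFactorial, Nat.add_sub_cancel_left]
    simp only [zsmul_eq_mul, nsmul_eq_mul, mul_one]
    push_cast
    rw [add_comm (1 : ℂ), pow_add]
    have : (-1 : ℂ) ^ m * (-1) ^ m = 1 := by rw [← mul_pow]; simp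
    linear_combination (-(-1 : ℂ) ^ j * (j + m).choose j * P.eval ((j : ℂ) + 1)) * this
  rw [key]
  split_ifs with h
  · subst h
    have h2 := Polynomial.fwdDiff_iter_degree_eq_factorial P
    rw [hP] at h2
    rw [h2, (monic_ascPochhammer ℂ k : P.leadingCoeff = 1)]
    simp
  · rw [Polynomial.fwdDiff_iter_eq_zero_of_degree_lt (by omega)]
    simp

theorem inner_powExp_phi (n k : ℕ) (hk : k ≤ n) :
    inner ℂ (powExp k 1 (by simp)) (phi n)
      = if k = n then (-1) ^ n * (n.factorial : ℂ) / 2 ^ (n + 1) else 0 := by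
  have h := congrArg (· / (2 : ℂ) ^ (k + 1)) (sum_neg_one_pow_mul_choose_mul_ascFactorial n k hk)
  rw [phi_eq_sum, inner_sum]
  simp only [inner_smul_right, inner_powExp]
  calc _ = _ := ?_
    _ = _ := h
    _ = _ := ?_
  · simp only [Finset.sum_div]
    refine Finset.sum_congr rfl fun j _ => ?_
    have h1 : (j.factorial : ℂ) ≠ 0 := by exact_mod_cast j.factorial_ne_zero
    have h2 : ((k + j).factorial : ℂ) = j.factorial * (j + 1).ascFactorial k := by
      rw [add_comm k j, ← Nat.factorial_mul_ascFactorial]; push_cast; rfl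
    rw [h2, map_one, one_add_one_eq_two, neg_pow (2 : ℂ)]
    field_simp
    ring
  · split_ifs with h
    · rw [h]
    · simp

/-- Expanding the function of smaller index into monomials, only the top term can survive. The value
`1/2` is the source of the factor `2` in the coefficients of `Π_N`. -/
theorem inner_phi_phi (m n : ℕ) : inner ℂ (phi m) (phi n) = if m = n then (1 / 2 : ℂ) else 0 := by
  wlog hmn : m ≤ n generalizing m n
  · rw [← inner_conj_symm, this n m (by omega)]
    have : m ≠ n := by omega
    simp [this, this.symm]
  nth_rw 1 [phi_eq_sum m]
  rw [sum_inner]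
  have : ∀ k ∈ Finset.range (m + 1), inner ℂ
      (((m.choose k : ℂ) * (-2) ^ k / k.factorial) • powExp k 1 (by simp)) (phi n)
      = if k = n then (1 / 2 : ℂ) else 0 := by
    intro k hk
    have hk := Finset.mem_range_succ_iff.1 hk
    rw [inner_smul_left, inner_powExp_phi n k (hk.trans hmn)]
    split_ifs with h
    · subst h
      obtain rfl : m = k := le_antisymm hmn hk
      have h1 : (m.factorial : ℂ) ≠ 0 := by exact_mod_cast m.factorial_ne_zero
      have h2 : (-1 : ℂ) ^ m * (-1) ^ m = 1 := by rw [← mul_pow]; simp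
      simp only [map_div₀, map_natCast, map_pow, map_neg, map_ofNat, Nat.choose_self,
        Nat.cast_one, one_mul]
      rw [neg_pow (2 : ℂ)]
      field_simp
      linear_combination (2 ^ (m + 1)) * h2
    · simp
  rw [Finset.sum_congr rfl this, Finset.sum_ite_eq']
  congr 1
  simp
  omega

/-! ### Projection of exponentials and its exact error. -/

theorem phi_mem_laguerreSpace {n N : ℕ} (h : n ≤ N) : phi n ∈ laguerreSpace N :=
  Submodule.subset_span ⟨⟨n, by omega⟩, rfl⟩

/-- The change of basis is triangular, and `φ_k` has nonzero leading coefficient. -/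
theorem powExp_mem_laguerreSpace {k N : ℕ} (h : k ≤ N) :
    powExp k 1 (by simp) ∈ laguerreSpace N := by
  induction k using Nat.strong_induction_on with
  | _ k ih =>
    have h1 := phi_mem_laguerreSpace h
    rw [phi_eq_sum, Finset.sum_range_succ] at h1
    rw [Submodule.add_mem_iff_right _ (Submodule.sum_mem _ fun j hj =>
      Submodule.smul_mem _ _ (ih j (Finset.mem_range.1 hj)
        ((Finset.mem_range.1 hj).le.trans h)))] at h1
    refine (Submodule.smul_mem_iff _ ?_).1 h1
    have : (k.factorial : ℂ) ≠ 0 := by exact_mod_cast k.factorial_ne_zero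
    simp [this]

theorem proj_apply_powExp_zero (N : ℕ) (s : ℂ) (hs : 0 < s.re) :
    proj N (powExp 0 s hs) = ∑ m ∈ Finset.range (N + 1),
      (2 * ((s - 1) ^ m / (s + 1) ^ (m + 1))) • phi m := by
  refine Submodule.eq_starProjection_of_mem_orthogonal
    (Submodule.sum_mem _ fun m hm => Submodule.smul_mem _ _
      (phi_mem_laguerreSpace (Finset.mem_range_succ_iff.1 hm))) ?_
  rw [laguerreSpace, Submodule.mem_orthogonal]
  intro u hu
  induction hu using Submodule.span_induction with
  | zero => simp
  | add x y _ _ hx hy => rw [inner_add_left, hx, hy, add_zero]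
  | smul c x _ hx => rw [inner_smul_left, hx, mul_zero]
  | mem x hx =>
    obtain ⟨n, rfl⟩ := hx
    have hn : (n : ℕ) ∈ Finset.range (N + 1) := Finset.mem_range.2 n.2
    simp only [inner_sub_right, inner_sum, inner_smul_right, inner_phi_phi, inner_phi_powExp_zero,
      mul_ite, mul_zero, Finset.sum_ite_eq, hn, if_true]
    ring

/-- By Pythagoras the error is the full norm `1 / (2 Re s)` minus a geometric sum of ratio
`|(s-1)/(s+1)|²`. Since `|s+1|² - |s-1|² = 4 Re s`, the whole series adds up to that norm and only
its tail remains. -/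
theorem norm_sub_proj_powExp_zero_sq (N : ℕ) (s : ℂ) (hs : 0 < s.re) :
    ‖powExp 0 s hs - proj N (powExp 0 s hs)‖ ^ 2
      = ‖(s - 1) / (s + 1)‖ ^ (2 * (N + 1)) / (2 * s.re) := by
  have h0 : s + 1 ≠ 0 := by
    intro h; have := congrArg Complex.re h; simp at this; linarith
  have h1 : ((‖powExp 0 s hs - proj N (powExp 0 s hs)‖ ^ 2 : ℝ) : ℂ)
      = inner ℂ (powExp 0 s hs) (powExp 0 s hs)
        - inner ℂ (proj N (powExp 0 s hs)) (powExp 0 s hs) := by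
    have := inner_self_eq_norm_sq_to_K (𝕜 := ℂ) (powExp 0 s hs - proj N (powExp 0 s hs))
    have h : inner ℂ (powExp 0 s hs - proj N (powExp 0 s hs)) (proj N (powExp 0 s hs)) = 0 :=
      (laguerreSpace N).starProjection_inner_eq_zero _ _ (Submodule.starProjection_apply_mem _ _)
    rw [inner_sub_right, h, sub_zero, inner_sub_left] at this
    rw [this]; simp
  have h2 : inner ℂ (powExp 0 s hs) (powExp 0 s hs) = 1 / (2 * (s.re : ℂ)) := by
    rw [inner_powExp, add_comm (conj s), Complex.add_conj]; simp
  have hre : (s.re : ℂ) ≠ 0 := by exact_mod_cast hs.ne'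
  have hns : ((‖s + 1‖ : ℝ) : ℂ) ≠ 0 := by simpa using h0
  have hdiff : ((‖s + 1‖ ^ 2 : ℝ) : ℂ) - ((‖s - 1‖ ^ 2 : ℝ) : ℂ) = 4 * s.re := by
    rw [Complex.sq_norm, Complex.sq_norm, Complex.normSq_apply, Complex.normSq_apply]
    simp; ring
  push_cast at hdiff
  have h3 : ∀ M : ℕ, ∑ m ∈ Finset.range M,
      conj (2 * ((s - 1) ^ m / (s + 1) ^ (m + 1))) * ((s - 1) ^ m / (s + 1) ^ (m + 1))
      = (1 - ((‖s - 1‖ / ‖s + 1‖ : ℝ) : ℂ) ^ (2 * M)) / (2 * s.re) := by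
    intro M
    induction M with
    | zero => simp
    | succ M ih =>
      rw [Finset.sum_range_succ, ih, map_mul, mul_assoc, Complex.conj_mul']
      simp only [norm_div, norm_pow, map_ofNat]
      push_cast
      have e : ((‖s - 1‖ : ℝ) : ℂ) ^ M = (‖s - 1‖ / ‖s + 1‖ : ℂ) ^ M * (‖s + 1‖ : ℂ) ^ M := by
        rw [div_pow, div_mul_cancel₀ _ (pow_ne_zero _ hns)]
      rw [e, show 2 * (M + 1) = 2 * M + 2 by ring, pow_add (_ / _ : ℂ), mul_comm 2 M,
        pow_mul (_ / _ : ℂ) M 2]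
      generalize (‖s - 1‖ / ‖s + 1‖ : ℂ) ^ M = t
      field_simp
      linear_combination (-t ^ 2 * (‖s + 1‖ : ℂ) ^ (2 * M + 2)) * hdiff
  have h4 := h3 (N + 1)
  apply Complex.ofReal_injective
  rw [h1, h2, proj_apply_powExp_zero, sum_inner]
  simp only [inner_smul_left, inner_phi_powExp_zero]
  rw [h4]
  push_cast [norm_div]
  ring

/-! ### Factorization of the error. -/

theorem add_ofReal_ne_zero {a : ℂ} (ha : a ∈ Complex.slitPlane) {x : ℝ} (hx : 0 ≤ x) :
    a + x ≠ 0 := by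
  intro h
  obtain rfl : a = ((-x : ℝ) : ℂ) := by push_cast; exact eq_neg_of_add_eq_zero_left h
  rw [Complex.ofReal_mem_slitPlane] at ha
  linarith

theorem invMul_coeFn {a : ℂ} (ha : a ∈ Complex.slitPlane) (f : L2) :
    invMul a ha f =ᵐ[halfLine] fun x : ℝ => 1 / (a + (x : ℂ)) * f x :=
  MemLp.coeFn_toLp _

/-- `invMul` as a linear map. -/
def invMulLinear {a : ℂ} (ha : a ∈ Complex.slitPlane) : L2 →ₗ[ℂ] L2 where
  toFun := invMul a ha
  map_add' f g := by
    refine Lp.ext ?_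
    filter_upwards [invMul_coeFn ha (f + g), invMul_coeFn ha f, invMul_coeFn ha g,
      Lp.coeFn_add f g, Lp.coeFn_add (invMul a ha f) (invMul a ha g)] with x h1 h2 h3 h4 h5
    simp only [h1, h5, h4, Pi.add_apply, h2, h3, mul_add]
  map_smul' c f := by
    refine Lp.ext ?_
    filter_upwards [invMul_coeFn ha (c • f), invMul_coeFn ha f,
      Lp.coeFn_smul c f, Lp.coeFn_smul c (invMul a ha f)] with x h1 h2 h4 h5
    simp only [h1, RingHom.id_apply, h5, h4, Pi.smul_apply, h2, smul_eq_mul]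
    ring

theorem invMul_powExp_succ {a : ℂ} (ha : a ∈ Complex.slitPlane) (k : ℕ) (s : ℂ) (hs : 0 < s.re) :
    invMul a ha (powExp (k + 1) s hs)
      = powExp k s hs - a • invMul a ha (powExp k s hs) := by
  refine Lp.ext ?_
  filter_upwards [invMul_coeFn ha (powExp (k + 1) s hs), invMul_coeFn ha (powExp k s hs),
    powExp_coeFn (k + 1) s hs, powExp_coeFn k s hs, ae_restrict_mem measurableSet_Ici,
    Lp.coeFn_smul a (invMul a ha (powExp k s hs)),
    Lp.coeFn_sub (powExp k s hs) (a • invMul a ha (powExp k s hs))] with x h1 h2 h3 h4 hx h5 h6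
  have := add_ofReal_ne_zero ha hx
  simp only [h1, h6, Pi.sub_apply, h5, Pi.smul_apply, h2, h3, h4, smul_eq_mul]
  field_simp
  ring

/-- The residual `I - Π_N` of the projection. -/
def residual (N : ℕ) : L2 →L[ℂ] L2 := ContinuousLinearMap.id ℂ L2 - proj N

theorem residual_apply (N : ℕ) (f : L2) : residual N f = f - proj N f := rfl

theorem residual_eq_zero {N : ℕ} {f : L2} (hf : f ∈ laguerreSpace N) : residual N f = 0 := by
  rw [residual_apply, proj, Submodule.starProjection_eq_self_iff.2 hf, sub_self]

/-- From `x / (a + x) = 1 - a / (a + x)`: modulo the Laguerre space, each factor `x` acts as `-a`.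
-/
theorem residual_invMul_powExp {a : ℂ} (ha : a ∈ Complex.slitPlane) {k N : ℕ} (hk : k ≤ N) :
    residual N (invMul a ha (powExp k 1 (by simp)))
      = (-a) ^ k • residual N (invMul a ha (powExp 0 1 (by simp))) := by
  induction k with
  | zero => simp
  | succ k ih =>
    rw [invMul_powExp_succ, map_sub, residual_eq_zero (powExp_mem_laguerreSpace (by omega)),
      map_smul, ih (by omega), zero_sub, smul_smul, ← neg_smul, pow_succ']
    congr 1
    ring

theorem residual_invMul_phi {a : ℂ} (ha : a ∈ Complex.slitPlane) {n N : ℕ} (hn : n ≤ N) :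
    residual N (invMul a ha (phi n))
      = laguerre n (-2 * a) • residual N (invMul a ha (powExp 0 1 (by simp))) := by
  change residual N (invMulLinear ha (phi n)) = _
  rw [phi_eq_sum, map_sum, map_sum, laguerre, Finset.sum_smul]
  refine Finset.sum_congr rfl fun k hk => ?_
  have hk := Finset.mem_range_succ_iff.1 hk
  rw [map_smul, map_smul]
  change _ • residual N (invMul a ha _) = _
  rw [residual_invMul_powExp ha (hk.trans hn), smul_smul, Nat.choose_symm hk,
    show -(-2 * a) = (-2) * (-a) by ring, mul_pow]
  congr 1
  ring

theorem divError_eq {a b : ℂ} (N : ℕ) (ha : a ∈ Complex.slitPlane) (hb : 0 < b.re) :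
    divError N a b ha hb
      = ‖∑ m ∈ Finset.range (N + 1),
          2 * ((b - 1) ^ m / (b + 1) ^ (m + 1)) * laguerre m (-2 * a)‖
        * ‖residual N (invMul a ha (powExp 0 1 (by simp)))‖ := by
  rw [← norm_smul, Finset.sum_smul, divError, ← residual_apply, expL2_eq_powExp,
    proj_apply_powExp_zero]
  change ‖residual N (invMulLinear ha _)‖ = _
  rw [map_sum, map_sum]
  congr 1
  refine Finset.sum_congr rfl fun m hm => ?_
  rw [map_smul, map_smul]
  change _ • residual N (invMul a ha _) = _
  rw [residual_invMul_phi ha (Finset.mem_range_succ_iff.1 hm), smul_smul]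

/-! ### Uniform bound for the scalar factor. -/

/-- Use `|z|^k / k! ≤ δ^k e^{|z|/δ}` in each term. As `δ` is free, the growth rate in `n` is as
close to `1` as desired. -/
theorem norm_laguerre_le (n : ℕ) (z : ℂ) {δ : ℝ} (hδ : 0 < δ) :
    ‖laguerre n z‖ ≤ Real.exp (‖z‖ / δ) * (1 + δ) ^ n := by
  rw [add_comm, add_pow, Finset.mul_sum, laguerre]
  refine norm_sum_le_of_le _ fun k hk => ?_
  have h := Real.pow_div_factorial_le_exp (‖z‖ / δ) (by positivity) k
  rw [Nat.choose_symm (Finset.mem_range_succ_iff.1 hk), norm_mul, norm_div, norm_pow, norm_neg,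
    Complex.norm_natCast, Complex.norm_natCast, one_pow, mul_one]
  calc (n.choose k : ℝ) * (‖z‖ ^ k / k.factorial)
      = ((‖z‖ / δ) ^ k / k.factorial) * (δ ^ k * n.choose k) := by
        rw [div_pow]; field_simp
    _ ≤ _ := by gcongr

theorem norm_sub_one_div_add_one_lt_one {b : ℂ} (hb : 0 < b.re) : ‖(b - 1) / (b + 1)‖ < 1 := by
  have h0 : b + 1 ≠ 0 := by
    intro h; have := congrArg Complex.re h; simp at this; linarith
  rw [norm_div, div_lt_one (norm_pos_iff.2 h0)]
  refine lt_of_pow_lt_pow_left₀ 2 (norm_nonneg _) ?_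
  rw [Complex.sq_norm, Complex.sq_norm, Complex.normSq_apply, Complex.normSq_apply]
  simp
  nlinarith

theorem exists_bound_sum_laguerre (z : ℂ) {b : ℂ} (hb : 0 < b.re) :
    ∃ K : ℝ, 0 < K ∧ ∀ M : ℕ, ‖∑ m ∈ Finset.range M,
      2 * ((b - 1) ^ m / (b + 1) ^ (m + 1)) * laguerre m z‖ ≤ K := by
  set r := ‖(b - 1) / (b + 1)‖ with hr
  have hr1 : r < 1 := norm_sub_one_div_add_one_lt_one hb
  have hr0 : 0 ≤ r := norm_nonneg _
  -- With this choice `1 - r (1 + δ) = (1 - r)(2 - r) / 2 > 0`.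
  set δ := (1 - r) / 2
  have hδ : 0 < δ := by simp only [δ]; linarith
  have hρ : r * (1 + δ) < 1 := by simp only [δ]; nlinarith
  have hρ0 : 0 ≤ r * (1 + δ) := by positivity
  have h0 : b + 1 ≠ 0 := by
    intro h; have := congrArg Complex.re h; simp at this; linarith
  have h1 : 0 < ‖b + 1‖ := norm_pos_iff.2 h0
  have h2 : 0 < 1 - r * (1 + δ) := by linarith
  refine ⟨2 / ‖b + 1‖ * Real.exp (‖z‖ / δ) * (1 - r * (1 + δ))⁻¹, by positivity, fun M => ?_⟩
  rw [← tsum_geometric_of_lt_one hρ0 hρ]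
  calc _ ≤ ∑ m ∈ Finset.range M, 2 / ‖b + 1‖ * Real.exp (‖z‖ / δ) * (r * (1 + δ)) ^ m := by
        refine norm_sum_le_of_le _ fun m _ => ?_
        have e : 2 * ((b - 1) ^ m / (b + 1) ^ (m + 1)) = 2 / (b + 1) * ((b - 1) / (b + 1)) ^ m := by
          rw [div_pow]; field_simp; ring
        rw [e, norm_mul, norm_mul, norm_div, norm_pow, ← hr, Complex.norm_ofNat, mul_pow]
        calc 2 / ‖b + 1‖ * r ^ m * ‖laguerre m z‖
            ≤ 2 / ‖b + 1‖ * r ^ m * (Real.exp (‖z‖ / δ) * (1 + δ) ^ m) := by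
              gcongr; exact norm_laguerre_le m z hδ
          _ = _ := by ring
    _ = 2 / ‖b + 1‖ * Real.exp (‖z‖ / δ) * ∑ m ∈ Finset.range M, (r * (1 + δ)) ^ m := by
        rw [Finset.mul_sum]
    _ ≤ _ := by
        gcongr
        exact (summable_geometric_of_lt_one hρ0 hρ).sum_le_tsum _ fun _ _ => by positivity

/-! ### Saddle-point estimates. -/

/-- With `x = β / (t + β)` the quotient is `(1 - x) / (1 + x)`; keep the first term of the series of
`log (1 + x) - log (1 - x)`. -/
theorem div_add_two_mul_le_exp {t β : ℝ} (ht : 0 < t) (hβ : 0 < β) :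
    t / (t + 2 * β) ≤ Real.exp (-(2 * β / (t + β))) := by
  set x := β / (t + β) with hx
  have hx0 : 0 < x := by positivity
  have hx1 : x < 1 := by rw [hx, div_lt_one (by positivity)]; linarith
  have h := Real.hasSum_log_sub_log_of_abs_lt_one (x := x) (by rwa [abs_of_pos hx0])
  have h2 : 2 * x ≤ Real.log (1 + x) - Real.log (1 - x) := by
    have := le_hasSum h 0 fun j _ => by positivity
    simpa using this
  have e : t / (t + 2 * β) = (1 - x) / (1 + x) := by rw [hx]; field_simp; ring
  rw [e, mul_div_assoc, ← hx, ← Real.log_le_iff_le_exp (by apply div_pos <;> linarith),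
    Real.log_div (by linarith) (by linarith)]
  linarith

/-- For `p = √(u² + β)`, `p² + d⁴/p² = 2d² + (p-d)²(p+d)²/p² ≥ 2d² + (p-d)²`. Returning from `p` to
`u` costs `β` twice: in `u² = p² - β`, and through `(p-u)² ≤ β` when `(p-d)²` is replaced by
`(u-d)²/2`. -/
theorem saddle_exponent_le {u β d : ℝ} (hu : 0 ≤ u) (hβ : 0 < β) (hd : 0 ≤ d) :
    2 * d ^ 2 + (u - d) ^ 2 / 2 - 2 * β ≤ u ^ 2 + (d ^ 2) ^ 2 / (u ^ 2 + β) := by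
  set p := √(u ^ 2 + β) with hp
  have hp2 : p ^ 2 = u ^ 2 + β := Real.sq_sqrt (by positivity)
  have hp0 : 0 < p := Real.sqrt_pos.2 (by positivity)
  have hup : u ≤ p := Real.le_sqrt_of_sq_le (by linarith)
  have h1 : (p - u) ^ 2 ≤ β := by nlinarith
  have h2 : (u - d) ^ 2 / 2 ≤ (p - u) ^ 2 + (p - d) ^ 2 := by
    nlinarith [sq_nonneg ((p - u) - (p - d)), sq_nonneg ((p - u) + (p - d))]
  have h3 : 2 * d ^ 2 + (p - d) ^ 2 ≤ p ^ 2 + (d ^ 2) ^ 2 / p ^ 2 := by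
    have : p ^ 2 + (d ^ 2) ^ 2 / p ^ 2 - (2 * d ^ 2 + (p - d) ^ 2)
        = (p - d) ^ 2 * (d * (2 * p + d)) / p ^ 2 := by field_simp; ring
    have : 0 ≤ (p - d) ^ 2 * (d * (2 * p + d)) / p ^ 2 := by positivity
    linarith
  rw [← hp2]
  linarith

/-- The quotient equals `u² / (u² + 2α)`, so its modulus is controlled by `Re α` alone. The saddle
is at `d = (2n)^(1/4)`, that is `d² = √(2n)`. -/
theorem norm_mul_div_two_add_mul_pow_le {α : ℂ} (hα : 0 < α.re) {u : ℝ} (hu : 0 < u) (n : ℕ) :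
    Real.exp (-(α.re * u ^ 2)) * ‖α⁻¹ * (u : ℂ) ^ 2 / (2 + α⁻¹ * (u : ℂ) ^ 2)‖ ^ n
      ≤ Real.exp (2 * α.re ^ 2) * Real.exp (-(2 * α.re * √(2 * n)))
        * Real.exp (-(α.re / 2) * (u - √√(2 * n)) ^ 2) := by
  set β := α.re
  have hα0 : α ≠ 0 := by rintro rfl; simp [β] at hα
  have h1 : ‖α⁻¹ * (u : ℂ) ^ 2 / (2 + α⁻¹ * (u : ℂ) ^ 2)‖ ≤ u ^ 2 / (u ^ 2 + 2 * β) := by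
    have e : α⁻¹ * (u : ℂ) ^ 2 / (2 + α⁻¹ * (u : ℂ) ^ 2)
        = (u : ℂ) ^ 2 / ((u : ℂ) ^ 2 + 2 * α) := by
      rw [show 2 + α⁻¹ * (u : ℂ) ^ 2 = α⁻¹ * ((u : ℂ) ^ 2 + 2 * α) by field_simp; ring,
        mul_div_mul_left _ _ (inv_ne_zero hα0)]
    rw [e, norm_div, norm_pow, Complex.norm_real, Real.norm_eq_abs, sq_abs]
    gcongr
    refine le_trans (le_of_eq ?_) (Complex.re_le_norm _)
    simp [β, ← Complex.ofReal_pow]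
  have h2 := div_add_two_mul_le_exp (t := u ^ 2) (β := β) (by positivity) hα
  have h3 : ‖α⁻¹ * (u : ℂ) ^ 2 / (2 + α⁻¹ * (u : ℂ) ^ 2)‖ ^ n
      ≤ Real.exp (-(2 * β / (u ^ 2 + β))) ^ n := by gcongr; exact h1.trans h2
  rw [← Real.exp_nat_mul] at h3
  refine (mul_le_mul_of_nonneg_left h3 (Real.exp_pos _).le).trans ?_
  rw [← Real.exp_add, ← Real.exp_add, ← Real.exp_add, Real.exp_le_exp]
  have h4 := saddle_exponent_le (d := √√(2 * n)) hu.le hα (Real.sqrt_nonneg _)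
  rw [Real.sq_sqrt (Real.sqrt_nonneg _), Real.sq_sqrt (by positivity)] at h4
  have h5 := mul_le_mul_of_nonneg_left h4 hα.le
  have e : (n : ℝ) * -(2 * β / (u ^ 2 + β)) = -(β * (2 * n / (u ^ 2 + β))) := by ring
  rw [e]
  linarith

/-! ### Integral representation and the residual of `e^{-x} / (a + x)`. -/

/-- The Laplace integral of `1 / (a + x)` along `t = u² / α`. On this ray convergence needs only `Re
α > 0`, so `Re a ≤ 0` is allowed. -/
theorem inv_add_ofReal_eq_integral {a α : ℂ} (hα : 0 < α.re) (ha : α ^ 2 = a) {x : ℝ}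
    (hx : 0 ≤ x) :
    1 / (a + x) = ∫ u in Set.Ioi (0 : ℝ),
      2 * α⁻¹ * ((u : ℂ) * Complex.exp (-(α + α⁻¹ * x) * (u : ℂ) ^ 2)) := by
  have hα0 : α ≠ 0 := by rintro rfl; simp at hα
  have h0 : 0 ≤ (α⁻¹ * x).re := by
    rw [Complex.re_mul_ofReal, Complex.inv_re]
    exact mul_nonneg (div_nonneg hα.le (Complex.normSq_nonneg α)) hx
  have h1 : 0 < (α + α⁻¹ * x).re := by rw [Complex.add_re]; linarith
  have h2 : α + α⁻¹ * x ≠ 0 := by intro h; rw [h] at h1; simp at h1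
  rw [integral_const_mul, integral_mul_cexp_neg_mul_sq h1, ← ha]
  have h3 : α ^ 2 + x = α * (α + α⁻¹ * x) := by field_simp
  rw [h3]
  field_simp

theorem integrable_conj_mul_exp (f : L2) :
    Integrable (fun x : ℝ => conj (f x) * Complex.exp (-x)) halfLine := by
  have h := L2.integrable_inner (𝕜 := ℂ) f (powExp 0 1 (by simp))
  refine h.congr ?_
  filter_upwards [powExp_coeFn 0 1 (by simp)] with x hx
  rw [hx, RCLike.inner_apply]
  simp [mul_comm]

theorem one_add_inv_mul_sq_re_pos {α : ℂ} (hα : 0 < α.re) (u : ℝ) :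
    0 < (1 + α⁻¹ * (u : ℂ) ^ 2).re := by
  rw [← Complex.ofReal_pow, Complex.add_re, Complex.re_mul_ofReal, Complex.inv_re, Complex.one_re]
  have := mul_nonneg (div_nonneg hα.le (Complex.normSq_nonneg α)) (sq_nonneg u)
  linarith

/-- The superposition in weak form: testing against `f` reduces it to Fubini for scalar integrals.
-/
theorem inner_invMul_exp_eq_integral {a α : ℂ} (ha : a ∈ Complex.slitPlane) (hα : 0 < α.re)
    (hαa : α ^ 2 = a) (f : L2) :
    inner ℂ f (invMul a ha (powExp 0 1 (by simp))) = ∫ u in Set.Ioi (0 : ℝ),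
      2 * α⁻¹ * ((u : ℂ) * Complex.exp (-α * (u : ℂ) ^ 2)) *
        inner ℂ f (powExp 0 (1 + α⁻¹ * (u : ℂ) ^ 2) (one_add_inv_mul_sq_re_pos hα u)) := by
  set F : ℝ → ℝ → ℂ := fun x u => (conj (f x) * Complex.exp (-x)) *
    (2 * α⁻¹ * ((u : ℂ) * Complex.exp (-α * (u : ℂ) ^ 2))) *
      Complex.exp (-(α⁻¹ * (u : ℂ) ^ 2) * x) with hF
  have hint : Integrable (Function.uncurry F) (halfLine.prod (volume.restrict (Set.Ioi 0))) := by
    -- A product of integrable functions of `x` and of `u`, times a coupling exponential of modulus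
    -- at most `1` for `x ≥ 0`.
    refine Integrable.mul_bdd (c := 1) ((integrable_conj_mul_exp f).mul_prod
      (((integrable_mul_cexp_neg_mul_sq hα).const_mul (2 * α⁻¹)).integrableOn)) ?_ ?_
    · exact (Continuous.aestronglyMeasurable (by fun_prop))
    · have h := (Measure.quasiMeasurePreserving_fst (μ := halfLine)
        (ν := volume.restrict (Set.Ioi (0 : ℝ)))).ae (ae_restrict_mem measurableSet_Ici)
      filter_upwards [h] with z hz
      have hz : 0 ≤ z.1 := hz
      rw [Complex.norm_exp, Real.exp_le_one_iff, ← Complex.ofReal_pow, neg_mul, Complex.neg_re,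
        Complex.re_mul_ofReal, Complex.re_mul_ofReal, Complex.inv_re]
      have := div_nonneg hα.le (Complex.normSq_nonneg α)
      have := mul_nonneg (mul_nonneg this (sq_nonneg z.2)) hz
      linarith
  have h1 : inner ℂ f (invMul a ha (powExp 0 1 (by simp)))
      = ∫ x, (∫ u in Set.Ioi (0 : ℝ), F x u) ∂halfLine := by
    rw [L2.inner_def]
    refine integral_congr_ae ?_
    filter_upwards [invMul_coeFn ha (powExp 0 1 (by simp)), powExp_coeFn 0 1 (by simp),
      ae_restrict_mem measurableSet_Ici] with x h1 h2 hx
    rw [RCLike.inner_apply, h1, h2, inv_add_ofReal_eq_integral hα hαa hx, ← integral_mul_const,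
      ← integral_mul_const]
    refine integral_congr_ae (Eventually.of_forall fun u => ?_)
    simp only [hF, pow_zero, one_mul]
    rw [show -(α + α⁻¹ * x) * (u : ℂ) ^ 2 = -α * (u : ℂ) ^ 2 + -(α⁻¹ * (u : ℂ) ^ 2) * x by ring,
      Complex.exp_add, neg_one_mul]
    ring
  rw [h1, integral_integral_swap hint]
  refine integral_congr_ae (Eventually.of_forall fun u => ?_)
  simp only
  rw [L2.inner_def, ← integral_const_mul]
  refine integral_congr_ae ?_
  filter_upwards [powExp_coeFn 0 _ (one_add_inv_mul_sq_re_pos hα u)] with x hx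
  rw [hx, RCLike.inner_apply, hF]
  simp only [pow_zero, one_mul]
  rw [show -(1 + α⁻¹ * (u : ℂ) ^ 2) * (x : ℂ) = -x + -(α⁻¹ * (u : ℂ) ^ 2) * x by ring,
    Complex.exp_add]
  ring

theorem inner_residual_left (N : ℕ) (f g : L2) :
    inner ℂ (residual N f) g = inner ℂ (residual N f) (residual N g) := by
  have h : inner ℂ (residual N f) (proj N g) = 0 :=
    (laguerreSpace N).starProjection_inner_eq_zero _ _ (Submodule.starProjection_apply_mem _ _)
  rw [residual_apply N g, inner_sub_right, h, sub_zero]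

/-- Since `Re s ≥ Re(α⁻¹) u²`, the factor `1 / √(2 Re s)` absorbs the `u` of the weight. -/
theorem norm_mul_norm_residual_powExp_le {α : ℂ} (hα : 0 < α.re) {u : ℝ} (hu : 0 < u) (N : ℕ) :
    ‖2 * α⁻¹ * ((u : ℂ) * Complex.exp (-α * (u : ℂ) ^ 2))‖ *
        ‖residual N (powExp 0 (1 + α⁻¹ * (u : ℂ) ^ 2) (one_add_inv_mul_sq_re_pos hα u))‖
      ≤ 2 * ‖α⁻¹‖ / √(2 * (α⁻¹).re) * Real.exp (2 * α.re ^ 2)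
        * Real.exp (-(2 * α.re * √(2 * (N + 1 : ℕ))))
        * Real.exp (-(α.re / 2) * (u - √√(2 * (N + 1 : ℕ))) ^ 2) := by
  set s := 1 + α⁻¹ * (u : ℂ) ^ 2 with hs
  have hα0 : α ≠ 0 := by rintro rfl; simp at hα
  have hω : 0 < (α⁻¹).re := by
    rw [Complex.inv_re]; exact div_pos hα (Complex.normSq_pos.2 hα0)
  have hsre : s.re = 1 + (α⁻¹).re * u ^ 2 := by
    rw [hs, ← Complex.ofReal_pow, Complex.add_re, Complex.re_mul_ofReal, Complex.one_re]
  have hs0 : 0 < s.re := by rw [hsre]; positivity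
  have h1 : ‖residual N (powExp 0 s hs0)‖
      ≤ ‖α⁻¹ * (u : ℂ) ^ 2 / (2 + α⁻¹ * (u : ℂ) ^ 2)‖ ^ (N + 1) / (√(2 * (α⁻¹).re) * u) := by
    refine (pow_le_pow_iff_left₀ (norm_nonneg _) (by positivity) two_ne_zero).1 ?_
    rw [residual_apply, norm_sub_proj_powExp_zero_sq, div_pow, ← pow_mul, mul_comm (N + 1) 2,
      mul_pow, Real.sq_sqrt (by positivity), show s - 1 = α⁻¹ * (u : ℂ) ^ 2 by rw [hs]; ring,
      show s + 1 = 2 + α⁻¹ * (u : ℂ) ^ 2 by rw [hs]; ring]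
    refine div_le_div_of_nonneg_left (by positivity) (by positivity) ?_
    rw [hsre]
    linarith
  have h2 : ‖2 * α⁻¹ * ((u : ℂ) * Complex.exp (-α * (u : ℂ) ^ 2))‖
      = 2 * ‖α⁻¹‖ * u * Real.exp (-(α.re * u ^ 2)) := by
    rw [norm_mul, norm_mul, norm_mul, Complex.norm_exp, Complex.norm_real, Complex.norm_ofNat,
      Real.norm_of_nonneg hu.le, ← Complex.ofReal_pow, Complex.re_mul_ofReal, Complex.neg_re]
    ring_nf
  rw [h2]
  have hq : 0 < √(2 * (α⁻¹).re) := Real.sqrt_pos.2 (by positivity)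
  calc _ ≤ 2 * ‖α⁻¹‖ * u * Real.exp (-(α.re * u ^ 2)) *
        (‖α⁻¹ * (u : ℂ) ^ 2 / (2 + α⁻¹ * (u : ℂ) ^ 2)‖ ^ (N + 1) / (√(2 * (α⁻¹).re) * u)) := by
        gcongr
    _ = 2 * ‖α⁻¹‖ / √(2 * (α⁻¹).re) * (Real.exp (-(α.re * u ^ 2)) *
        ‖α⁻¹ * (u : ℂ) ^ 2 / (2 + α⁻¹ * (u : ℂ) ^ 2)‖ ^ (N + 1)) := by field_simp
    _ ≤ 2 * ‖α⁻¹‖ / √(2 * (α⁻¹).re) * (Real.exp (2 * α.re ^ 2)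
        * Real.exp (-(2 * α.re * √(2 * (N + 1 : ℕ))))
        * Real.exp (-(α.re / 2) * (u - √√(2 * (N + 1 : ℕ))) ^ 2)) := by
        exact mul_le_mul_of_nonneg_left (norm_mul_div_two_add_mul_pow_le hα hu (N + 1))
          (by positivity)
    _ = _ := by ring

theorem norm_residual_invMul_exp_le {a α : ℂ} (ha : a ∈ Complex.slitPlane) (hα : 0 < α.re)
    (hαa : α ^ 2 = a) (N : ℕ) :
    ‖residual N (invMul a ha (powExp 0 1 (by simp)))‖
      ≤ 2 * ‖α⁻¹‖ / √(2 * (α⁻¹).re) * Real.exp (2 * α.re ^ 2) * √(Real.pi / (α.re / 2))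
        * Real.exp (-(2 * α.re * √(2 * (N + 1 : ℕ)))) := by
  set h := invMul a ha (powExp 0 1 (by simp))
  set f := residual N h with hf
  set A := 2 * ‖α⁻¹‖ / √(2 * (α⁻¹).re) * Real.exp (2 * α.re ^ 2)
        * Real.exp (-(2 * α.re * √(2 * (N + 1 : ℕ))))
  have hA : 0 ≤ A := by positivity
  have hβ : 0 < α.re / 2 := by positivity
  have hg := (integrable_exp_neg_mul_sq hβ).comp_sub_right (√√(2 * (N + 1 : ℕ)))
  have h1 : ‖f‖ * ‖f‖ = ‖inner ℂ f h‖ := by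
    rw [inner_residual_left, inner_self_eq_norm_sq_to_K]
    simp [sq, hf]
  -- The residual is tested against itself; under the integral, `inner_residual_left` moves `I -
  -- Π_N` onto each exponential.
  have h2 : ‖f‖ * ‖f‖ ≤ ‖f‖ * (A * √(Real.pi / (α.re / 2))) := by
    rw [h1, inner_invMul_exp_eq_integral ha hα hαa]
    refine (norm_integral_le_of_norm_le (g := fun u => ‖f‖ * (A *
      Real.exp (-(α.re / 2) * (u - √√(2 * (N + 1 : ℕ))) ^ 2)))
      ((hg.const_mul A).const_mul ‖f‖).integrableOn ?_).trans ?_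
    · filter_upwards [ae_restrict_mem measurableSet_Ioi] with u hu
      rw [inner_residual_left, norm_mul]
      refine (mul_le_mul_of_nonneg_left (norm_inner_le_norm _ _) (norm_nonneg _)).trans ?_
      rw [mul_left_comm]
      exact mul_le_mul_of_nonneg_left (norm_mul_norm_residual_powExp_le hα hu N) (norm_nonneg _)
    · rw [integral_const_mul, integral_const_mul]
      gcongr
      refine (setIntegral_le_integral hg (Eventually.of_forall fun u => (Real.exp_pos _).le)).trans
        (le_of_eq ?_)
      rw [integral_sub_right_eq_self (fun u : ℝ => Real.exp (-(α.re / 2) * u ^ 2)),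
        integral_gaussian]
  have h3 : ‖f‖ ≤ A * √(Real.pi / (α.re / 2)) := by
    rcases (norm_nonneg f).eq_or_lt with h0 | h0
    · rw [← h0]; positivity
    · exact le_of_mul_le_mul_left h2 h0
  refine h3.trans (le_of_eq ?_)
  ring

/-! ### Real part of the principal square root. -/

theorem sqrt_re_pos {a : ℂ} (ha : a ∈ Complex.slitPlane) : 0 < (Complex.sqrt a).re := by
  have h0 := Complex.slitPlane_ne_zero ha
  have h1 := Complex.mem_slitPlane_iff_arg.1 ha
  have h2 := Complex.neg_pi_lt_arg a
  have h3 := lt_of_le_of_ne (Complex.arg_le_pi a) h1.1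
  rw [Complex.sqrt, Complex.cpow_def_of_ne_zero h0, Complex.exp_re]
  refine mul_pos (Real.exp_pos _) (Real.cos_pos_of_mem_Ioo ?_)
  have : (Complex.log a * 2⁻¹).im = a.arg / 2 := by
    rw [show (2⁻¹ : ℂ) = ((2⁻¹ : ℝ) : ℂ) by simp, Complex.im_mul_ofReal, Complex.log_im]
    ring
  rw [this]
  constructor <;> linarith

theorem sqrt_ofReal_mul_re {r : ℝ} (hr : 0 ≤ r) (a : ℂ) :
    (Complex.sqrt (r * a)).re = √r * (Complex.sqrt a).re := by
  rw [Complex.sqrt, Complex.sqrt, Complex.cpow_inv_two_re, Complex.cpow_inv_two_re, norm_mul,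
    Complex.norm_of_nonneg hr, Complex.re_ofReal_mul, ← mul_add, mul_div_assoc, Real.sqrt_mul hr]

end LaguerreApprox

end

theorem mainTheorem7 (a b : ℂ) (ha : a ∈ Complex.slitPlane) (hb : 0 < b.re) :
    ∃ C : ℝ, 0 < C ∧ ∀ N : ℕ,
      LaguerreApprox.divError N a b ha hb ≤
        C * Real.exp (-2 * (Complex.sqrt (2 * a * ((N : ℂ) + 1))).re) := by
  open LaguerreApprox in
  obtain ⟨K, hK, hbd⟩ := exists_bound_sum_laguerre (-2 * a) hb
  have hα := sqrt_re_pos ha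
  set α := Complex.sqrt a with hαdef
  have hαa : α ^ 2 = a := by
    rw [hαdef, Complex.sqrt]; exact Complex.cpow_ofNat_inv_pow a 2
  have hα0 : α ≠ 0 := by rintro h; simp [h] at hα
  have hω : 0 < (α⁻¹).re := by
    rw [Complex.inv_re]; exact div_pos hα (Complex.normSq_pos.2 hα0)
  have hω' : 0 < ‖α⁻¹‖ := norm_pos_iff.2 (inv_ne_zero hα0)
  refine ⟨K * (2 * ‖α⁻¹‖ / √(2 * (α⁻¹).re) * Real.exp (2 * α.re ^ 2) * √(Real.pi / (α.re / 2))),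
    by positivity, fun N => ?_⟩
  have e : (Complex.sqrt (2 * a * ((N : ℂ) + 1))).re = √(2 * (N + 1 : ℕ)) * α.re := by
    rw [show 2 * a * ((N : ℂ) + 1) = ((2 * (N + 1 : ℕ) : ℝ) : ℂ) * a by push_cast; ring,
      sqrt_ofReal_mul_re (by positivity)]
  rw [e, divError_eq, mul_assoc K]
  refine mul_le_mul (hbd _) ((norm_residual_invMul_exp_le ha hα hαa N).trans (le_of_eq ?_))
    (norm_nonneg _) hK.le
  congr 2
  ring
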